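/- **Setting.** A finite set of $n$ nodes exchanges authenticated messages; $f$ is a natural number with $n>3f$, and $d>0$. Every node $q$ has a local timer that runs at the rate of real time from an arbitrary offset; $rt(\tau)$ is the real time at which $q$'s timer reads $\tau$. From some real time $\iota_0$ on the system is *coherent*: at least $n-f$ nodes are *correct* (the others are Byzantine); each message that a correct node sends to all is received and processed by every correct node after a positive delay of at most $d$; and from $\iota_0+d$ on, a message is logged as coming from a correct node only if that node sent it at most $d$ earlier. Before $\iota_0$ everything (sent messages, logs) is arbitrary. Let $t_{skew}\ge 0$, $\Phi=t_{skew}+2d$, $\Delta_{agr}=(2f+1)\Phi$, $\Delta_{rmv}=\Delta_{agr}+13d$, $\Delta_{reset}=20d+4\Delta_{rmv}$; the system is *stable* from $\iota_1=\iota_0+2\Delta_{reset}$ on. **Anchors.** In one agreement instance, the primitive Initiator may let a node $q$ *I-accept*; this supplies $q$ with an *anchor* $\tau^G_q$, a local time. The contract of Initiator is: correct nodes I-accept at real times $\ge\iota_1$; the anchor lies in the past, $rt(\tau^G_q)\le t$ if $q$ I-accepts at real time $t$; and if a correct node $q$ I-accepts at real time $t$ with $t-rt(\tau^G_q)\le\Delta_{agr}$,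 then every correct node $q'$ I-accepts at some real time $t'$ with $|t-t'|\le 2d$ and $|rt(\tau^G_q)-rt(\tau^G_{q'})|\le t_{skew}$. (In the protocol, $t_{skew}=6d$.) **The primitive msgd-broadcast.** From its I-accept on, a correct node $q$ runs the following code for every triple $(p,m,k)$ ($p$ a node, $m$ a value, $k\in\mathbb N$). Messages are logged also before the I-accept and are removed from the log when older than $(2f+3)\Phi$; a message of each kind is sent once, as soon as its condition holds, and the same goes for accepting; $\tau_q$ is the current local time. - V: if $q=p$ and $q$ invokes the primitive on $(p,m,k)$ (at most once per triple), send $(init,p,m,k)$ to all; we say that $p$ broadcasts $(p,m,k)$. - W: while $\tau_q\le\tau^G_q+2k\Phi$: if $(init,p,m,k)$ was received from $p$, send $(echo,p,m,k)$ to all. - X: while $\tau_q\le\tau^G_q+(2k+1)\Phi$: if $(echo,p,m,k)$ was received from $\ge n-2f$ distinct nodes, send $(init',p,m,k)$ to all; if from $\ge n-f$, accept $(p,m,k)$. - Y: while $\tau_q\le\tau^G_q+(2k+2)\Phi$: if $(init',p,m,k)$ was received from $\ge n-2f$ distinct nodes, add $p$ to $broadcasters$ (an entry older than $(2f+3)\Phi$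 is removed); if from $\ge n-f$, send $(echo',p,m,k)$ to all. - Z: at any time: if $(echo',p,m,k)$ was received from $\ge n-2f$ distinct nodes, send $(echo',p,m,k)$ to all; if from $\ge n-f$, accept $(p,m,k)$. **Theorem.** In every such execution, msgd-broadcast satisfies: - **TPS-1 (Correctness).** If a correct node $p$ broadcasts $(p,m,k)$, $k\le f+1$, at local time $\tau_p\le\tau^G_p+(2k-1)\Phi$, then every correct node $q$ accepts $(p,m,k)$ at some local time $\tau_q\le\tau^G_q+(2k+1)\Phi$ with $|rt(\tau_p)-rt(\tau_q)|\le 3d$. - **TPS-2 (Unforgeability).** If a correct node $p$ does not broadcast $(p,m,k)$, then no correct node accepts $(p,m,k)$. - **TPS-3 (Relay).** If a correct node $q_1$ accepts $(p,m,k)$ at local time $\tau_1\le\tau^G_{q_1}+r\Phi$, where $r\in\mathbb N$, $r\le 2f+1$, then every correct node $q_2$ accepts $(p,m,k)$ at some local time $\tau_2\le\tau^G_{q_2}+(r+2)\Phi$. - **TPS-4 (Detection of broadcasters).** If a correct node accepts $(p,m,k)$, $k\le f$, then every correct node $q$ has $p\in broadcasters$ at some local time $\tau_q\le\tau^G_q+(2k+2)\Phi$.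 Furthermore, if a correct node $p$ broadcasts no message, then no correct node ever has $p\in broadcasters$. -/

import Mathlib

/-- The four kinds of messages exchanged by the message-driven broadcast primitive. -/
inductive MsgKind where
  | init
  | echo
  | initPrime
  | echoPrime

/-- A message `(kind, p, m, k)`: it concerns the broadcast of the value `m` by node `p` in
round `k`. -/
structure Msg (Node Val : Type*) where
  kind : MsgKind
  p : Node
  m : Val
  k : ℕ

/-- The trace of one agreement instance in a network: raw data, subject to no law whatsoever.
The laws are the predicates further down.  All times of type `ℝ` are real times, except anchors,
which are readings of local timers. -/
structure Run (Node Val : Type*) where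
  /-- upper bound on the number of nodes that are not correct -/
  f : ℕ
  /-- upper bound on the time from the sending of a message by a correct node until it has been
  received and processed by every correct node -/
  d : ℝ
  /-- the bound `τ_skew` on the distance between anchors that enters the length of a phase
  (it is `6 * d` for the primitive Initiator) -/
  skew : ℝ
  /-- the correct nodes; the other nodes are Byzantine -/
  correct : Finset Node
  /-- the local timer of `q` reads `t + offset q` at real time `t` -/
  offset : Node → ℝ
  /-- the real time `ι₀` from which on the system is coherent; before it, everything is
  arbitrary -/
  coherentFrom : ℝ
  /-- `some (t, g)`: the node I-accepts at real time `t`, which supplies it with the anchor `g`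
  (a local time); `none`: the node does not I-accept in this instance -/
  iaccept : Node → Option (ℝ × ℝ)
  /-- `invoke p m k t`: node `p` invokes the primitive on `(p, m, k)` at real time `t` -/
  invoke : Node → Val → ℕ → ℝ → Prop
  /-- `send q M t`: node `q` sends the message `M` to all nodes at real time `t`
  (only meaningful for correct nodes) -/
  send : Node → Msg Node Val → ℝ → Prop
  /-- `recv q s M t`: at real time `t`, node `q` has received and processed the message `M` and
  logs it as a message from `s` -/
  recv : Node → Node → Msg Node Val → ℝ → Prop
  /-- `accept q p m k t`: node `q` accepts `(p, m, k)` at real time `t` -/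
  accept : Node → Node → Val → ℕ → ℝ → Prop

namespace Run

variable {Node Val : Type*}

section Constants

variable (R : Run Node Val)

/-- The length `Φ` of a phase. -/
def phase : ℝ := R.skew + 2 * R.d

/-- `Δ_agr`, the bound on the duration of the agreement protocol. -/
def durAgr : ℝ := (2 * R.f + 1) * R.phase

/-- `Δ_rmv`, where `13 * d` is the minimal time between two initiations of one General. -/
def durRmv : ℝ := R.durAgr + 13 * R.d

/-- `Δ_reset`. -/
def durReset : ℝ := 20 * R.d + 4 * R.durRmv

/-- The system is stable from this real time `ι₁ = ι₀ + 2 Δ_reset` on. -/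
def stableFrom : ℝ := R.coherentFrom + 2 * R.durReset

/-- The age at which the cleanup of the primitive removes a value or message. -/
def keep : ℝ := (2 * R.f + 3) * R.phase

/-- The reading of the local timer of `q` at real time `t`. -/
def clock (q : Node) (t : ℝ) : ℝ := t + R.offset q

/-- The real time `rt(τ)` at which the local timer of `q` reads `τ`. -/
def rt (q : Node) (τ : ℝ) : ℝ := τ - R.offset q

end Constants

/-- The system is coherent from `ι₀` on: at least `n - f` nodes are correct; every message that a
correct node sends is delivered to every correct node within `d`; and, from `ι₀ + d` on, a message
is logged as coming from a correct node only if that node sent it at most `d` earlier. -/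
structure Coherent [Fintype Node] (R : Run Node Val) : Prop where
  d_pos : 0 < R.d
  quorum : Fintype.card Node - R.f ≤ R.correct.card
  delivery : ∀ s ∈ R.correct, ∀ q ∈ R.correct, ∀ (M : Msg Node Val) (u : ℝ),
    R.coherentFrom ≤ u → R.send s M u → ∃ t, u < t ∧ t ≤ u + R.d ∧ R.recv q s M t
  authentic : ∀ s ∈ R.correct, ∀ q ∈ R.correct, ∀ (M : Msg Node Val) (t : ℝ),
    R.coherentFrom + R.d ≤ t → R.recv q s M t → ∃ u, u < t ∧ t ≤ u + R.d ∧ R.send s M u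

/-- The contract of the primitive Initiator towards the caller of the broadcast primitive, for an
instance that takes place when the system is stable.  An anchor estimates a past event, and
(relay) if a correct node I-accepts with an anchor that is at most `Δ_agr` old, then every correct
node I-accepts within `2 d` of it, with an anchor within `τ_skew` of its anchor in real time. -/
structure AnchorsSupplied (R : Run Node Val) : Prop where
  skew_nonneg : 0 ≤ R.skew
  stable : ∀ q ∈ R.correct, ∀ t g : ℝ, R.iaccept q = some (t, g) → R.stableFrom ≤ t
  past : ∀ q ∈ R.correct, ∀ t g : ℝ, R.iaccept q = some (t, g) → R.rt q g ≤ t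
  relay : ∀ q ∈ R.correct, ∀ t g : ℝ, R.iaccept q = some (t, g) →
    t - R.rt q g ≤ R.durAgr →
      ∀ q' ∈ R.correct, ∃ t' g' : ℝ, R.iaccept q' = some (t', g') ∧
        |t - t'| ≤ 2 * R.d ∧ |R.rt q g - R.rt q' g'| ≤ R.skew

/-- At real time `t` node `q` executes the primitive: its anchor is defined. -/
def Running (R : Run Node Val) (q : Node) (t : ℝ) : Prop :=
  ∃ t₀ g, R.iaccept q = some (t₀, g) ∧ t₀ ≤ t

/-- At real time `t` node `q` executes the primitive and its timer shows at most `b` more than its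
anchor: `τ_q ≤ τ^G_q + b`. -/
def Within (R : Run Node Val) (q : Node) (t b : ℝ) : Prop :=
  ∃ t₀ g, R.iaccept q = some (t₀, g) ∧ t₀ ≤ t ∧ R.clock q t ≤ g + b

/-- The distinct nodes from which the log of `q` at real time `t` holds the message `M`.  Messages
are logged also before the anchor is defined, and those older than `(2f + 3) Φ` are removed. -/
def heard (R : Run Node Val) (q : Node) (M : Msg Node Val) (t : ℝ) : Set Node :=
  {s | ∃ u, u ≤ t ∧ R.clock q t - R.clock q u ≤ R.keep ∧ R.recv q s M u}

/-- From `ι₀` on, the action `E` is taken exactly when its condition `C` holds for the first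
time, and only once. -/
def DoneOnce (R : Run Node Val) (E C : ℝ → Prop) : Prop :=
  (∀ t, R.coherentFrom ≤ t → E t → C t) ∧
  (∀ t, R.coherentFrom ≤ t → C t → ∃ s, R.coherentFrom ≤ s ∧ s ≤ t ∧ E s) ∧
  (∀ s t, R.coherentFrom ≤ s → R.coherentFrom ≤ t → E s → E t → s = t)

section Conditions

variable [Fintype Node] (R : Run Node Val) (q p : Node) (m : Val) (k : ℕ) (t : ℝ)

/-- Block W: condition for sending `(echo, p, m, k)`. -/
def echoCond : Prop :=
  R.Within q t (2 * k * R.phase) ∧ p ∈ R.heard q ⟨.init, p, m, k⟩ t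

/-- Lines X1-X2: condition for sending `(init', p, m, k)`. -/
def initPrimeCond : Prop :=
  R.Within q t ((2 * k + 1) * R.phase) ∧
    Fintype.card Node - 2 * R.f ≤ (R.heard q ⟨.echo, p, m, k⟩ t).ncard

/-- Lines Y1-Y2: condition for adding `p` to `broadcasters`. -/
def broadcasterCond : Prop :=
  R.Within q t ((2 * k + 2) * R.phase) ∧
    Fintype.card Node - 2 * R.f ≤ (R.heard q ⟨.initPrime, p, m, k⟩ t).ncard

/-- Lines Y4 and Z2: condition for sending `(echo', p, m, k)`. -/
def echoPrimeCond : Prop :=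
  (R.Within q t ((2 * k + 2) * R.phase) ∧
    Fintype.card Node - R.f ≤ (R.heard q ⟨.initPrime, p, m, k⟩ t).ncard) ∨
  (R.Running q t ∧
    Fintype.card Node - 2 * R.f ≤ (R.heard q ⟨.echoPrime, p, m, k⟩ t).ncard)

/-- Lines X4 and Z4: condition for accepting `(p, m, k)`. -/
def acceptCond : Prop :=
  (R.Within q t ((2 * k + 1) * R.phase) ∧
    Fintype.card Node - R.f ≤ (R.heard q ⟨.echo, p, m, k⟩ t).ncard) ∨
  (R.Running q t ∧
    Fintype.card Node - R.f ≤ (R.heard q ⟨.echoPrime, p, m, k⟩ t).ncard)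

end Conditions

/-- From `ι₀` on, every correct node follows the code of the broadcast primitive.  When, by whom
and on what it is invoked is up to the caller; it is invoked only when the anchor is defined, and
at most once per triple. -/
structure FollowsPrimitive [Fintype Node] (R : Run Node Val) : Prop where
  invoke_running : ∀ q ∈ R.correct, ∀ (m : Val) (k : ℕ) (t : ℝ),
    R.coherentFrom ≤ t → R.invoke q m k t → R.Running q t
  invoke_once : ∀ q ∈ R.correct, ∀ (m : Val) (k : ℕ) (s t : ℝ),
    R.coherentFrom ≤ s → R.coherentFrom ≤ t → R.invoke q m k s → R.invoke q m k t → s = t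
  init : ∀ q ∈ R.correct, ∀ (p : Node) (m : Val) (k : ℕ) (t : ℝ), R.coherentFrom ≤ t →
    (R.send q ⟨.init, p, m, k⟩ t ↔ p = q ∧ R.invoke q m k t)
  echo : ∀ q ∈ R.correct, ∀ (p : Node) (m : Val) (k : ℕ),
    R.DoneOnce (R.send q ⟨.echo, p, m, k⟩) (R.echoCond q p m k)
  initPrime : ∀ q ∈ R.correct, ∀ (p : Node) (m : Val) (k : ℕ),
    R.DoneOnce (R.send q ⟨.initPrime, p, m, k⟩) (R.initPrimeCond q p m k)
  echoPrime : ∀ q ∈ R.correct, ∀ (p : Node) (m : Val) (k : ℕ),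
    R.DoneOnce (R.send q ⟨.echoPrime, p, m, k⟩) (R.echoPrimeCond q p m k)
  accept : ∀ q ∈ R.correct, ∀ (p : Node) (m : Val) (k : ℕ),
    R.DoneOnce (R.accept q p m k) (R.acceptCond q p m k)

/-- Node `p`, with anchor `g`, broadcasts `(p, m, k)` at real time `t`. -/
def BroadcastsAt (R : Run Node Val) (p : Node) (m : Val) (k : ℕ) (t g : ℝ) : Prop :=
  ∃ t₀, R.iaccept p = some (t₀, g) ∧ t₀ ≤ t ∧ R.invoke p m k t

/-- Node `q`, with anchor `g`, accepts `(p, m, k)` at real time `t`. -/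
def AcceptsAt (R : Run Node Val) (q p : Node) (m : Val) (k : ℕ) (t g : ℝ) : Prop :=
  ∃ t₀, R.iaccept q = some (t₀, g) ∧ t₀ ≤ t ∧ R.accept q p m k t

/-- Node `q`, with anchor `g`, has `p ∈ broadcasters` at real time `t`: it has added `p`, and not
so long ago that the entry has been removed by the cleanup. -/
def HasBroadcasterAt [Fintype Node] (R : Run Node Val) (q p : Node) (t g : ℝ) : Prop :=
  ∃ t₀, R.iaccept q = some (t₀, g) ∧ t₀ ≤ t ∧
    ∃ (m : Val) (k : ℕ) (s : ℝ), t₀ ≤ s ∧ s ≤ t ∧ R.clock q t - R.clock q s ≤ R.keep ∧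
      R.broadcasterCond q p m k s

/-- TPS-1, Correctness. -/
def Correctness (R : Run Node Val) : Prop :=
  ∀ p ∈ R.correct, ∀ (m : Val) (k : ℕ) (tp gp : ℝ), k ≤ R.f + 1 →
    R.BroadcastsAt p m k tp gp → R.clock p tp ≤ gp + (2 * (k : ℝ) - 1) * R.phase →
      ∀ q ∈ R.correct, ∃ tq gq, R.AcceptsAt q p m k tq gq ∧
        R.clock q tq ≤ gq + (2 * (k : ℝ) + 1) * R.phase ∧ |tp - tq| ≤ 3 * R.d

/-- TPS-2, Unforgeability. -/
def Unforgeability (R : Run Node Val) : Prop :=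
  ∀ p ∈ R.correct, ∀ (m : Val) (k : ℕ), (¬ ∃ t g, R.BroadcastsAt p m k t g) →
    ∀ q ∈ R.correct, ¬ ∃ t g, R.AcceptsAt q p m k t g

/-- TPS-3, Relay. -/
def Relay (R : Run Node Val) : Prop :=
  ∀ q₁ ∈ R.correct, ∀ (p : Node) (m : Val) (k r : ℕ) (t₁ g₁ : ℝ), r ≤ 2 * R.f + 1 →
    R.AcceptsAt q₁ p m k t₁ g₁ → R.clock q₁ t₁ ≤ g₁ + r * R.phase →
      ∀ q₂ ∈ R.correct, ∃ t₂ g₂, R.AcceptsAt q₂ p m k t₂ g₂ ∧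
        R.clock q₂ t₂ ≤ g₂ + ((r : ℝ) + 2) * R.phase

/-- TPS-4, Detection of broadcasters. -/
def Detection [Fintype Node] (R : Run Node Val) : Prop :=
  (∀ q₁ ∈ R.correct, ∀ (p : Node) (m : Val) (k : ℕ) (t₁ g₁ : ℝ), k ≤ R.f →
    R.AcceptsAt q₁ p m k t₁ g₁ →
      ∀ q ∈ R.correct, ∃ t g, R.HasBroadcasterAt q p t g ∧
        R.clock q t ≤ g + (2 * (k : ℝ) + 2) * R.phase) ∧
  (∀ p ∈ R.correct, (¬ ∃ m k t g, R.BroadcastsAt p m k t g) →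
    ∀ q ∈ R.correct, ¬ ∃ t g, R.HasBroadcasterAt q p t g)

end Run

namespace Run

variable {Node Val : Type*}

/-! The proof traces messages backwards in time and propagates them forwards.

Backwards: since n > 3f, a log quorum of n - 2f contains a correct sender, and one of n - f contains
n - 2f of them (`exists_last_sender`). Passing to earlier and earlier correct senders leads from an
acceptance by way of init' and echo to an invocation by p. Messages echo' can trigger each other,
but the earliest correct one stems from init' messages (`exists_first_echoPrime`). This gives
unforgeability and the negative half of detection.

Forwards: `Synced L T` replaces the individual anchors by one real time L before all of them. From T
on, a local deadline b past the anchor is still open at real time L + b, and messages of correct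
nodes stay logged until L + `keep`. A node at most b ≤ Δ_agr past its anchor at time t yields such
an L with t ≤ L + skew + b (`synced_of_within`). One phase Φ = skew + 2d thus pays for the change of
anchor and for the 2d until all correct nodes run.

The acceptor's own anchor may be too old, or its bound too weak, to show that a window is open. The
last correct sender in its quorum then supplies the anchor: the deadline for its message bounds how
far it is past that anchor. -/

/-- The hypotheses on an execution: resilience, coherence, anchors and the code. -/
structure Admissible [Fintype Node] (R : Run Node Val) : Prop where
  resilience : 3 * R.f < Fintype.card Node
  coherent : R.Coherent
  anchors : R.AnchorsSupplied
  follows : R.FollowsPrimitive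

/-- Every node in `S` sends `M` between `ι₀` and `t`. -/
def SentBy (R : Run Node Val) (S : Set Node) (M : Msg Node Val) (t : ℝ) : Prop :=
  ∀ s ∈ S, ∃ u, R.coherentFrom ≤ u ∧ u ≤ t ∧ R.send s M u

/-- Every correct node has I-accepted by time `T`, with an anchor not before the real time `L`. -/
def Synced (R : Run Node Val) (L T : ℝ) : Prop :=
  ∀ q ∈ R.correct, ∃ t g, R.iaccept q = some (t, g) ∧ t ≤ T ∧ L ≤ R.rt q g

/-! ### Extremal send times and uniform synchronization bounds -/

theorem exists_last_of_forall_exists {α : Type*} [Finite α] {S : Set α} (hS : S.Nonempty)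
    {P : α → ℝ → Prop} (h : ∀ s ∈ S, ∃ u, P s u) :
    ∃ s ∈ S, ∃ u, P s u ∧ ∀ s' ∈ S, ∃ u' ≤ u, P s' u' := by
  choose! u hu using h
  obtain ⟨s, hs, hmax⟩ := S.exists_max_image u S.toFinite hS
  exact ⟨s, hs, u s, hu s hs, fun s' hs' => ⟨u s', hmax s' hs', hu s' hs'⟩⟩

theorem exists_first_of_forall_exists {α : Type*} [Finite α] {S : Set α} (hS : S.Nonempty)
    {P : α → ℝ → Prop} (h : ∀ s ∈ S, ∃ u, P s u) :
    ∃ s ∈ S, ∃ u, P s u ∧ ∀ s' ∈ S, ∃ u' ≥ u, P s' u' := by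
  choose! u hu using h
  obtain ⟨s, hs, hmin⟩ := S.exists_min_image u S.toFinite hS
  exact ⟨s, hs, u s, hu s hs, fun s' hs' => ⟨u s', hmin s' hs', hu s' hs'⟩⟩

theorem Within.running {R : Run Node Val} {q : Node} {t b : ℝ} (h : R.Within q t b) :
    R.Running q t := by
  obtain ⟨t₀, g, h, ht, -⟩ := h
  exact ⟨t₀, g, h, ht⟩

theorem Synced.mono {R : Run Node Val} {L T T' : ℝ} (h : R.Synced L T) (hT : T ≤ T') :
    R.Synced L T' := by
  intro q hq
  obtain ⟨t, g, h, ht, hL⟩ := h q hq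
  exact ⟨t, g, h, ht.trans hT, hL⟩

theorem Synced.running {R : Run Node Val} {L T : ℝ} (h : R.Synced L T) {q : Node}
    (hq : q ∈ R.correct) : R.Running q T := by
  obtain ⟨t, g, h, ht, -⟩ := h q hq
  exact ⟨t, g, h, ht⟩

theorem Synced.within {R : Run Node Val} {L T b : ℝ} (h : R.Synced L T) {q : Node}
    (hq : q ∈ R.correct) (hb : T ≤ L + b) : R.Within q T b := by
  obtain ⟨t, g, h, ht, hL⟩ := h q hq
  refine ⟨t, g, h, ht, ?_⟩
  unfold rt at hL
  unfold clock
  linarith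

theorem Synced.clock_le {R : Run Node Val} {L T : ℝ} (hL : R.Synced L T) {q p : Node}
    (hq : q ∈ R.correct) {m : Val} {k : ℕ} {t g b : ℝ} (ha : R.AcceptsAt q p m k t g)
    (hb : t ≤ L + b) : R.clock q t ≤ g + b := by
  obtain ⟨t₀, hi, -⟩ := ha
  obtain ⟨t', g', hi', -, hg⟩ := hL q hq
  rw [hi] at hi'
  obtain ⟨rfl, rfl⟩ : t₀ = t' ∧ g = g' := by simpa using hi'
  unfold rt at hg
  unfold clock
  linarith

namespace Admissible

variable [Fintype Node] {R : Run Node Val}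

/-! ### Time constants, stability, and when correct nodes send -/

theorem two_d_le_phase (h : R.Admissible) : 2 * R.d ≤ R.phase := by
  have := h.anchors.skew_nonneg
  unfold phase
  linarith

theorem phase_pos (h : R.Admissible) : 0 < R.phase := by
  have := h.two_d_le_phase
  have := h.coherent.d_pos
  linarith

/-- The stable period starts so late that every entry still in a log then was recorded after ι₀ + d,
where authenticity holds; arbitrary earlier entries have expired. -/
theorem keep_add_le (h : R.Admissible) : R.coherentFrom + R.keep + R.d ≤ R.stableFrom := by
  have hd := h.coherent.d_pos
  have hp := h.phase_pos
  have hf : 0 ≤ (R.f : ℝ) * R.phase := by positivity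
  unfold stableFrom durReset durRmv durAgr keep
  nlinarith

theorem keep_nonneg (h : R.Admissible) : 0 ≤ R.keep := by
  have hp := h.phase_pos
  unfold keep
  positivity

theorem stable_of_running (h : R.Admissible) {q : Node} (hq : q ∈ R.correct) {t : ℝ}
    (ht : R.Running q t) : R.stableFrom ≤ t := by
  obtain ⟨t₀, g, hi, hle⟩ := ht
  exact (h.anchors.stable q hq t₀ g hi).trans hle

theorem coherent_of_running (h : R.Admissible) {q : Node} (hq : q ∈ R.correct) {t : ℝ}
    (ht : R.Running q t) : R.coherentFrom ≤ t := by
  have := h.stable_of_running hq ht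
  have := h.keep_add_le
  have := h.keep_nonneg
  have := h.coherent.d_pos
  linarith

theorem running_of_send (h : R.Admissible) {q : Node} (hq : q ∈ R.correct) {M : Msg Node Val}
    {t : ℝ} (ht : R.coherentFrom ≤ t) (hs : R.send q M t) : R.Running q t := by
  obtain ⟨kind, p, m, k⟩ := M
  cases kind with
  | init => exact h.follows.invoke_running q hq m k t ht ((h.follows.init q hq p m k t ht).1 hs).2
  | echo => exact ((h.follows.echo q hq p m k).1 t ht hs).1.running
  | initPrime => exact ((h.follows.initPrime q hq p m k).1 t ht hs).1.running
  | echoPrime =>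
    rcases (h.follows.echoPrime q hq p m k).1 t ht hs with hc | hc
    · exact hc.1.running
    · exact hc.1

theorem synced_of_iaccept (h : R.Admissible) {q : Node} (hq : q ∈ R.correct) {t g : ℝ}
    (hi : R.iaccept q = some (t, g)) (hage : t - R.rt q g ≤ R.durAgr) :
    R.Synced (R.rt q g - R.skew) (t + 2 * R.d) := by
  intro q' hq'
  obtain ⟨t', g', hi', h1, h2⟩ := h.anchors.relay q hq t g hi hage q' hq'
  rw [abs_le] at h1 h2
  exact ⟨t', g', hi', by linarith, by linarith⟩

/-- Sending requires a prior I-accept, and the anchor lies before that I-accept. -/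
theorem le_of_send (h : R.Admissible) {L T : ℝ} (hs : R.Synced L T) {q : Node}
    (hq : q ∈ R.correct) {M : Msg Node Val} {u : ℝ} (hu : R.coherentFrom ≤ u)
    (hsend : R.send q M u) : L ≤ u := by
  obtain ⟨t, g, hi, hle⟩ := h.running_of_send hq hu hsend
  obtain ⟨t', g', hi', -, hL⟩ := hs q hq
  rw [hi] at hi'
  obtain ⟨rfl, rfl⟩ : t = t' ∧ g = g' := by simpa using hi'
  exact hL.trans ((h.anchors.past q hq t g hi).trans hle)

/-! ### Quorums and authenticity of log entries -/

theorem ncard_sub_le (h : R.Admissible) (S : Set Node) :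
    S.ncard ≤ (S ∩ R.correct).ncard + R.f := by
  have h1 := Set.ncard_inter_add_ncard_sdiff_eq_ncard S (R.correct : Set Node) S.toFinite
  have h2 : (S \ (R.correct : Set Node)).ncard ≤ ((R.correct : Set Node)ᶜ).ncard :=
    Set.ncard_le_ncard (fun _ hx => hx.2) (Set.toFinite _)
  have h3 := Set.ncard_add_ncard_compl (R.correct : Set Node)
  rw [Set.ncard_coe_finset, Nat.card_eq_fintype_card] at h3
  have h4 := h.coherent.quorum
  have h5 := h.resilience
  omega

theorem exists_sent_of_mem_heard (h : R.Admissible) {q s : Node} (hq : q ∈ R.correct)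
    (hs : s ∈ R.correct) {M : Msg Node Val} {t : ℝ} (ht : R.Running q t)
    (hm : s ∈ R.heard q M t) : ∃ u, R.coherentFrom ≤ u ∧ u < t ∧ R.send s M u := by
  obtain ⟨v, hv, hk, hr⟩ := hm
  have h1 := h.stable_of_running hq ht
  have h2 := h.keep_add_le
  unfold clock at hk
  obtain ⟨u, hu, hu', hsend⟩ := h.coherent.authentic s hs q hq M v (by linarith) hr
  exact ⟨u, by linarith, by linarith, hsend⟩

theorem exists_sent_of_quorum (h : R.Admissible) {q : Node} (hq : q ∈ R.correct)
    {M : Msg Node Val} {t : ℝ} (ht : R.Running q t)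
    (hc : Fintype.card Node - 2 * R.f ≤ (R.heard q M t).ncard) :
    ∃ s ∈ R.correct, ∃ u, R.coherentFrom ≤ u ∧ u < t ∧ R.send s M u := by
  have h1 := h.ncard_sub_le (R.heard q M t)
  have h2 := h.resilience
  obtain ⟨s, hs, hs'⟩ : (R.heard q M t ∩ R.correct).Nonempty :=
    (Set.ncard_pos (Set.toFinite _)).1 (by omega)
  exact ⟨s, hs', h.exists_sent_of_mem_heard hq hs' ht hs⟩

/-- At the last send time u, all of S has already sent, while the sender s satisfies its own sending
condition at u. The time u is thus tied to the deadline of s instead of that of the receiver q. -/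
theorem exists_last_sender (h : R.Admissible) {q : Node} (hq : q ∈ R.correct)
    {M : Msg Node Val} {t : ℝ} (ht : R.Running q t)
    (hc : Fintype.card Node - R.f ≤ (R.heard q M t).ncard) :
    ∃ S ⊆ (R.correct : Set Node), Fintype.card Node - 2 * R.f ≤ S.ncard ∧
      ∃ s ∈ R.correct, ∃ u, R.coherentFrom ≤ u ∧ u < t ∧ R.send s M u ∧ R.SentBy S M u := by
  have h1 := h.ncard_sub_le (R.heard q M t)
  have h2 := h.resilience
  have hne : (R.heard q M t ∩ R.correct).Nonempty :=
    (Set.ncard_pos (Set.toFinite _)).1 (by omega)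
  obtain ⟨s, hs, u, hu, hlast⟩ := exists_last_of_forall_exists hne
    fun s hs => h.exists_sent_of_mem_heard hq hs.2 ht hs.1
  refine ⟨R.heard q M t ∩ R.correct, Set.inter_subset_right, by omega, s, hs.2,
    u, hu.1, hu.2.1, hu.2.2, ?_⟩
  intro s' hs'
  obtain ⟨u', hle, hu'⟩ := hlast s' hs'
  exact ⟨u', hu'.1, hle, hu'.2.2⟩

/-! ### Tracing messages back to an invocation -/

theorem exists_invoke_of_echo (h : R.Admissible) {p s : Node} (hp : p ∈ R.correct)
    (hs : s ∈ R.correct) {m : Val} {k : ℕ} {t : ℝ} (ht : R.coherentFrom ≤ t)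
    (hsend : R.send s ⟨.echo, p, m, k⟩ t) :
    ∃ u, R.coherentFrom ≤ u ∧ u < t ∧ R.invoke p m k u := by
  obtain ⟨hw, hm⟩ := (h.follows.echo s hs p m k).1 t ht hsend
  obtain ⟨u, hu, hlt, hi⟩ := h.exists_sent_of_mem_heard hs hp hw.running hm
  exact ⟨u, hu, hlt, ((h.follows.init p hp p m k u hu).1 hi).2⟩

theorem exists_invoke_of_initPrime (h : R.Admissible) {p s : Node} (hp : p ∈ R.correct)
    (hs : s ∈ R.correct) {m : Val} {k : ℕ} {t : ℝ} (ht : R.coherentFrom ≤ t)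
    (hsend : R.send s ⟨.initPrime, p, m, k⟩ t) :
    ∃ u, R.coherentFrom ≤ u ∧ u < t ∧ R.invoke p m k u := by
  obtain ⟨hw, hc⟩ := (h.follows.initPrime s hs p m k).1 t ht hsend
  obtain ⟨s', hs', v, hv, hvt, he⟩ := h.exists_sent_of_quorum hs hw.running hc
  obtain ⟨u, hu, huv, hi⟩ := h.exists_invoke_of_echo hp hs' hv he
  exact ⟨u, hu, huv.trans hvt, hi⟩

/-- The first correct node to send `(echo', p, m, k)` has done so because of its `init'` log. -/
theorem exists_first_echoPrime (h : R.Admissible) {p q : Node} (hq : q ∈ R.correct)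
    {m : Val} {k : ℕ} {t : ℝ} (ht : R.coherentFrom ≤ t)
    (hsend : R.send q ⟨.echoPrime, p, m, k⟩ t) :
    ∃ s ∈ R.correct, ∃ u, u ≤ t ∧ R.Within s u ((2 * k + 2) * R.phase) ∧
      Fintype.card Node - R.f ≤ (R.heard s ⟨.initPrime, p, m, k⟩ u).ncard := by
  let A : Set Node := {s | s ∈ R.correct ∧
    ∃ u, R.coherentFrom ≤ u ∧ R.send s ⟨.echoPrime, p, m, k⟩ u}
  obtain ⟨s, hs, u, ⟨hu, hsu⟩, hfirst⟩ := exists_first_of_forall_exists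
    (S := A) ⟨q, hq, t, ht, hsend⟩ fun s hs => hs.2
  -- The minimum was taken over one chosen send time per node; sending only once extends it to all
  -- send times.
  have key : ∀ s' ∈ R.correct, ∀ v, R.coherentFrom ≤ v →
      R.send s' ⟨.echoPrime, p, m, k⟩ v → u ≤ v := by
    intro s' hs' v hv hsv
    obtain ⟨u', hle, hu', hsu'⟩ := hfirst s' ⟨hs', v, hv, hsv⟩
    rwa [(h.follows.echoPrime s' hs' p m k).2.2 v u' hv hu' hsv hsu']
  refine ⟨s, hs.1, u, key q hq t ht hsend, ?_⟩
  rcases (h.follows.echoPrime s hs.1 p m k).1 u hu hsu with hc | ⟨hr, hc⟩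
  · exact hc
  -- Delays are positive, so a trigger by echo' messages would give a strictly earlier correct
  -- sender.
  · obtain ⟨s', hs', v, hv, hvu, hsv⟩ := h.exists_sent_of_quorum hs.1 hr hc
    exact absurd (key s' hs' v hv hsv) (not_le.2 hvu)

theorem exists_invoke_of_acceptCond (h : R.Admissible) {p q : Node} (hp : p ∈ R.correct)
    (hq : q ∈ R.correct) {m : Val} {k : ℕ} {t : ℝ} (hc : R.acceptCond q p m k t) :
    ∃ u, R.coherentFrom ≤ u ∧ u < t ∧ R.invoke p m k u := by
  rcases hc with ⟨hw, hc⟩ | ⟨hr, hc⟩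
  · obtain ⟨-, -, -, s, hs, v, hv, hvt, hsv, -⟩ := h.exists_last_sender hq hw.running hc
    obtain ⟨u, hu, huv, hi⟩ := h.exists_invoke_of_echo hp hs hv hsv
    exact ⟨u, hu, huv.trans hvt, hi⟩
  · obtain ⟨-, -, -, s, hs, v, hv, hvt, hsv, -⟩ := h.exists_last_sender hq hr hc
    obtain ⟨s', hs', w, hwv, hw, hcw⟩ := h.exists_first_echoPrime hs hv hsv
    obtain ⟨-, -, -, s'', hs'', x, hx, hxw, hsx, -⟩ := h.exists_last_sender hs' hw.running hcw
    obtain ⟨u, hu, hux, hi⟩ := h.exists_invoke_of_initPrime hp hs'' hx hsx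
    exact ⟨u, hu, by linarith, hi⟩

theorem exists_broadcastsAt_of_invoke (h : R.Admissible) {p : Node} (hp : p ∈ R.correct)
    {m : Val} {k : ℕ} {t : ℝ} (ht : R.coherentFrom ≤ t) (hi : R.invoke p m k t) :
    ∃ g, R.BroadcastsAt p m k t g := by
  obtain ⟨t₀, g, ha, hle⟩ := h.follows.invoke_running p hp m k t ht hi
  exact ⟨g, t₀, ha, hle, hi⟩

theorem acceptCond_of_acceptsAt (h : R.Admissible) {p q : Node} (hq : q ∈ R.correct) {m : Val}
    {k : ℕ} {t g : ℝ} (ha : R.AcceptsAt q p m k t g) : R.acceptCond q p m k t := by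
  obtain ⟨t₀, hi, hle, ha⟩ := ha
  exact (h.follows.accept q hq p m k).1 t (h.coherent_of_running hq ⟨t₀, g, hi, hle⟩) ha

theorem exists_acceptsAt (h : R.Admissible) {p q : Node} (hq : q ∈ R.correct) {m : Val}
    {k : ℕ} {t : ℝ} (hc : R.acceptCond q p m k t) :
    ∃ s g, s ≤ t ∧ R.AcceptsAt q p m k s g := by
  have hrun : ∀ s, R.acceptCond q p m k s → R.Running q s := by
    rintro s (hs | hs)
    exacts [hs.1.running, hs.1]
  obtain ⟨s, hs, hst, ha⟩ := (h.follows.accept q hq p m k).2.1 t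
    (h.coherent_of_running hq (hrun t hc)) hc
  obtain ⟨t₀, g, hi, hle⟩ := hrun s ((h.follows.accept q hq p m k).1 s hs ha)
  exact ⟨s, g, hst, t₀, hi, hle, ha⟩

/-! ### Propagation of messages among synchronized nodes -/

/-- The message is sent, hence received, no earlier than L, so its age at time t is at most t - L ≤
`keep`. The receiver need not have I-accepted when the message arrives. -/
theorem mem_heard (h : R.Admissible) {L T : ℝ} (hL : R.Synced L T) {q s : Node}
    (hq : q ∈ R.correct) (hs : s ∈ R.correct) {M : Msg Node Val} {u t : ℝ}
    (hu : R.coherentFrom ≤ u) (hsend : R.send s M u) (ht : u + R.d ≤ t) (hk : t ≤ L + R.keep) :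
    s ∈ R.heard q M t := by
  have h1 := h.le_of_send hL hs hu hsend
  obtain ⟨v, huv, hvd, hr⟩ := h.coherent.delivery s hs q hq M u hu hsend
  refine ⟨v, by linarith, ?_, hr⟩
  unfold clock
  linarith

theorem le_ncard_heard (h : R.Admissible) {L T : ℝ} (hL : R.Synced L T) {q : Node}
    (hq : q ∈ R.correct) {S : Set Node} (hS : S ⊆ R.correct) {M : Msg Node Val} {u t : ℝ}
    (hsent : R.SentBy S M u) (ht : u + R.d ≤ t) (hk : t ≤ L + R.keep) :
    S.ncard ≤ (R.heard q M t).ncard := by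
  refine Set.ncard_le_ncard (fun s hs => ?_) (Set.toFinite _)
  obtain ⟨v, hv, hvu, hsend⟩ := hsent s hs
  exact h.mem_heard hL hq (hS hs) hv hsend (by linarith) hk

theorem le_ncard_heard_of_correct (h : R.Admissible) {L T : ℝ} (hL : R.Synced L T) {q : Node}
    (hq : q ∈ R.correct) {M : Msg Node Val} {u t : ℝ} (hsent : R.SentBy R.correct M u)
    (ht : u + R.d ≤ t) (hk : t ≤ L + R.keep) :
    Fintype.card Node - R.f ≤ (R.heard q M t).ncard := by
  refine h.coherent.quorum.trans ?_
  rw [← Set.ncard_coe_finset]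
  exact h.le_ncard_heard hL hq subset_rfl hsent ht hk

theorem coherent_le_of_synced (h : R.Admissible) {L T : ℝ} (hL : R.Synced L T) {q : Node}
    (hq : q ∈ R.correct) : R.coherentFrom ≤ T :=
  h.coherent_of_running hq (hL.running hq)

theorem sentBy_initPrime (h : R.Admissible) {L T : ℝ} {S : Set Node} {p : Node} {m : Val}
    {k : ℕ} (hL : R.Synced L (T + 2 * R.d)) (hS : S ⊆ R.correct)
    (hc : Fintype.card Node - 2 * R.f ≤ S.ncard) (hsent : R.SentBy S ⟨.echo, p, m, k⟩ T)
    (hb : T + 2 * R.d ≤ L + (2 * k + 1) * R.phase) (hk : T + 2 * R.d ≤ L + R.keep) :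
    R.SentBy R.correct ⟨.initPrime, p, m, k⟩ (T + 2 * R.d) := by
  intro q hq
  have hd := h.coherent.d_pos
  exact (h.follows.initPrime q hq p m k).2.1 _ (h.coherent_le_of_synced hL hq)
    ⟨hL.within hq hb, hc.trans (h.le_ncard_heard hL hq hS hsent (by linarith) hk)⟩

theorem sentBy_echoPrime (h : R.Admissible) {L T : ℝ} {p : Node} {m : Val} {k : ℕ}
    (hL : R.Synced L T) (hsent : R.SentBy R.correct ⟨.initPrime, p, m, k⟩ T)
    (hb : T + R.d ≤ L + (2 * k + 2) * R.phase) (hk : T + R.d ≤ L + R.keep) :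
    R.SentBy R.correct ⟨.echoPrime, p, m, k⟩ (T + R.d) := by
  intro q hq
  have hL' := hL.mono (le_add_of_nonneg_right h.coherent.d_pos.le)
  exact (h.follows.echoPrime q hq p m k).2.1 _ (h.coherent_le_of_synced hL' hq)
    (.inl ⟨hL'.within hq hb, h.le_ncard_heard_of_correct hL hq hsent le_rfl hk⟩)

theorem exists_acceptsAt_of_echoPrime (h : R.Admissible) {L T : ℝ} {p : Node} {m : Val} {k : ℕ}
    (hL : R.Synced L T) (hsent : R.SentBy R.correct ⟨.echoPrime, p, m, k⟩ T)
    (hk : T + R.d ≤ L + R.keep) {q : Node} (hq : q ∈ R.correct) :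
    ∃ t g, t ≤ T + R.d ∧ R.AcceptsAt q p m k t g :=
  h.exists_acceptsAt hq (.inr
    ⟨(hL.mono (le_add_of_nonneg_right h.coherent.d_pos.le)).running hq,
      h.le_ncard_heard_of_correct hL hq hsent le_rfl hk⟩)

/-- All correct nodes send init' by T + 2d and echo' by T + 3d, and accept by T + 4d. Only the init'
deadline needs a hypothesis: the next window closes a phase, at least 2d, later, and accepting on
echo' has no deadline. -/
theorem exists_acceptsAt_of_echo (h : R.Admissible) {L T : ℝ} {S : Set Node} {p : Node}
    {m : Val} {k : ℕ} (hL : R.Synced L (T + 2 * R.d)) (hS : S ⊆ R.correct)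
    (hc : Fintype.card Node - 2 * R.f ≤ S.ncard) (hsent : R.SentBy S ⟨.echo, p, m, k⟩ T)
    (hb : T + 2 * R.d ≤ L + (2 * k + 1) * R.phase) (hk : T + 4 * R.d ≤ L + R.keep) {q : Node}
    (hq : q ∈ R.correct) : ∃ t g, t ≤ T + 4 * R.d ∧ R.AcceptsAt q p m k t g := by
  have hd := h.coherent.d_pos
  have hp := h.two_d_le_phase
  have h1 := h.sentBy_initPrime hL hS hc hsent hb (by linarith)
  have h2 := h.sentBy_echoPrime hL h1 (by linarith) (by linarith)
  obtain ⟨t, g, ht, ha⟩ := h.exists_acceptsAt_of_echoPrime (hL.mono (by linarith)) h2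
    (by linarith) hq
  exact ⟨t, g, by linarith, ha⟩

theorem broadcasterCond_of_initPrime (h : R.Admissible) {L T u : ℝ} {S : Set Node} {p : Node}
    {m : Val} {k : ℕ} (hL : R.Synced L T) (hS : S ⊆ R.correct)
    (hc : Fintype.card Node - 2 * R.f ≤ S.ncard)
    (hsent : R.SentBy S ⟨.initPrime, p, m, k⟩ u) (hu : u + R.d ≤ T)
    (hb : T ≤ L + (2 * k + 2) * R.phase) (hk : T ≤ L + R.keep) {q : Node}
    (hq : q ∈ R.correct) : R.broadcasterCond q p m k T :=
  ⟨hL.within hq hb, hc.trans (h.le_ncard_heard hL hq hS hsent hu hk)⟩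

/-! ### Anchor transfer and the four properties -/

/-- A correct node which is at most `b ≤ Δ_agr` past its anchor at time `t` synchronizes all
correct nodes. -/
theorem synced_of_within (h : R.Admissible) {q : Node} (hq : q ∈ R.correct) {t b : ℝ}
    (hw : R.Within q t b) (hb : b ≤ R.durAgr) :
    ∃ L, R.Synced L (t + 2 * R.d) ∧ t ≤ L + R.skew + b := by
  obtain ⟨t₀, g, hi, hle, hg⟩ := hw
  have hr : t ≤ R.rt q g + b := by
    unfold clock at hg
    unfold rt
    linarith
  exact ⟨_, (h.synced_of_iaccept hq hi (by linarith)).mono (by linarith), by linarith⟩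

theorem unforgeability (h : R.Admissible) : R.Unforgeability := by
  rintro p hp m k hno q hq ⟨t, g, ha⟩
  obtain ⟨u, hu, -, hi⟩ :=
    h.exists_invoke_of_acceptCond hp hq (h.acceptCond_of_acceptsAt hq ha)
  exact hno ⟨u, h.exists_broadcastsAt_of_invoke hp hu hi⟩

theorem correctness (h : R.Admissible) : R.Correctness := by
  rintro p hp m k t g hk ⟨t₀, hi, hle, hinv⟩ hclock q hq
  have hd := h.coherent.d_pos
  have hph := h.two_d_le_phase
  have hsk := h.anchors.skew_nonneg
  have hkr : (k : ℝ) * R.phase ≤ (R.f + 1) * R.phase :=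
    mul_le_mul_of_nonneg_right (by exact_mod_cast hk) h.phase_pos.le
  -- The bound k ≤ f + 1 is what makes (2k - 1)Φ at most Δ_agr.
  obtain ⟨L, hL, htL⟩ := h.synced_of_within hp ⟨t₀, g, hi, hle, hclock⟩
    (by unfold durAgr; linarith)
  have hι := h.coherent_of_running hp ⟨t₀, g, hi, hle⟩
  have hpd : R.phase = R.skew + 2 * R.d := rfl
  have hkp : R.keep = 2 * (R.f * R.phase) + 3 * R.phase := by unfold keep; ring
  have hecho : R.SentBy R.correct ⟨.echo, p, m, k⟩ (t + 2 * R.d) := fun s hs =>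
    (h.follows.echo s hs p m k).2.1 _ (h.coherent_le_of_synced hL hs)
      ⟨hL.within hs (by linarith), h.mem_heard hL hs hp hι
        ((h.follows.init p hp p m k t hι).2 ⟨rfl, hinv⟩) (by linarith) (by linarith)⟩
  have hL' : R.Synced L (t + 3 * R.d) := hL.mono (by linarith)
  obtain ⟨s, gq, hs, ha⟩ := h.exists_acceptsAt (p := p) (m := m) (k := k) (t := t + 3 * R.d) hq
    (.inl ⟨hL'.within hq (by linarith),
      h.le_ncard_heard_of_correct hL hq hecho (by linarith) (by linarith)⟩)
  refine ⟨s, gq, ha, hL.clock_le hq ha (by linarith), ?_⟩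
  -- Acceptance cannot precede the broadcast: it is preceded by some invocation, and the invocation
  -- is unique.
  obtain ⟨u, hu, hus, hinv'⟩ :=
    h.exists_invoke_of_acceptCond hp hq (h.acceptCond_of_acceptsAt hq ha)
  obtain rfl := h.follows.invoke_once p hp m k u t hu hι hinv' hinv
  rw [abs_le]
  constructor <;> linarith

theorem relay (h : R.Admissible) : R.Relay := by
  intro q₁ hq₁ p m k r t₁ g₁ hr ha hclock q₂ hq₂
  have hd := h.coherent.d_pos
  have hph := h.two_d_le_phase
  have hpos := h.phase_pos
  have hsk := h.anchors.skew_nonneg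
  have hpd : R.phase = R.skew + 2 * R.d := rfl
  have hkp : R.keep = 2 * (R.f * R.phase) + 3 * R.phase := by unfold keep; ring
  have hag : R.durAgr = 2 * (R.f * R.phase) + R.phase := by unfold durAgr; ring
  have hrr : (r : ℝ) * R.phase ≤ (2 * R.f + 1) * R.phase :=
    mul_le_mul_of_nonneg_right (by exact_mod_cast hr) hpos.le
  have hcond := h.acceptCond_of_acceptsAt hq₁ ha
  obtain ⟨t₀, hi, hle, -⟩ := ha
  obtain ⟨L, hL, htL⟩ := h.synced_of_within hq₁ ⟨t₀, g₁, hi, hle, hclock⟩ (by linarith)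
  suffices ∃ t g, t ≤ t₁ + 4 * R.d ∧ R.AcceptsAt q₂ p m k t g by
    obtain ⟨t, g, ht, ha⟩ := this
    exact ⟨t, g, ha, hL.clock_le hq₂ ha (by linarith)⟩
  rcases hcond with ⟨hw, hc⟩ | ⟨hrun, hc⟩
  · obtain ⟨S, hS, hcS, s, hs, u, hu, hut, hsend, hsent⟩ :=
      h.exists_last_sender hq₁ hw.running hc
    -- For r ≤ 2k the acceptor's anchor shows that the init' window is open everywhere at t₁ + 2d,
    -- however large k is. For larger r that bound is too weak, and the anchor of the last echo
    -- sender is used.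
    rcases le_or_gt r (2 * k) with hrk | hrk
    · have hrk' : (r : ℝ) * R.phase ≤ (2 * k) * R.phase :=
        mul_le_mul_of_nonneg_right (by exact_mod_cast hrk) hpos.le
      refine h.exists_acceptsAt_of_echo hL hS hcS (fun s' hs' => ?_) (by linarith)
        (by linarith) hq₂
      obtain ⟨v, hv, hvu, hsv⟩ := hsent s' hs'
      exact ⟨v, hv, hvu.trans hut.le, hsv⟩
    -- From 2k < r ≤ 2f + 1 follows k ≤ f, so the echo sender is at most Δ_agr past its anchor.
    · have hkf : ((2 * k : ℕ) : ℝ) * R.phase ≤ ((2 * R.f : ℕ) : ℝ) * R.phase :=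
        mul_le_mul_of_nonneg_right (by exact_mod_cast (by omega)) hpos.le
      push_cast at hkf
      obtain ⟨hws, -⟩ := (h.follows.echo s hs p m k).1 u hu hsend
      obtain ⟨L', hL', huL⟩ := h.synced_of_within hs hws (by linarith)
      obtain ⟨t, g, ht, ha⟩ := h.exists_acceptsAt_of_echo hL' hS hcS hsent (by linarith)
        (by linarith) hq₂
      exact ⟨t, g, by linarith, ha⟩
  · obtain ⟨S, hS, hcS, s, hs, u, hu, hut, hsend, hsent⟩ := h.exists_last_sender hq₁ hrun hc
    -- The messages arrive by t₁ + d; the second d ensures that every correct node has I-accepted.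
    have hsent' : R.SentBy R.correct ⟨.echoPrime, p, m, k⟩ (t₁ + 2 * R.d) := fun q hq =>
      (h.follows.echoPrime q hq p m k).2.1 _ (h.coherent_le_of_synced hL hq)
        (.inr ⟨hL.running hq,
          hcS.trans (h.le_ncard_heard hL hq hS hsent (by linarith) (by linarith))⟩)
    obtain ⟨t, g, ht, ha⟩ := h.exists_acceptsAt_of_echoPrime hL hsent' (by linarith) hq₂
    exact ⟨t, g, by linarith, ha⟩

theorem exists_hasBroadcasterAt (h : R.Admissible) {L T : ℝ} {p q : Node} {m : Val} {k : ℕ}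
    (hL : R.Synced L T) (hq : q ∈ R.correct) (hb : T ≤ L + (2 * k + 2) * R.phase)
    (hc : R.broadcasterCond q p m k T) :
    ∃ t g, R.HasBroadcasterAt q p t g ∧ R.clock q t ≤ g + (2 * (k : ℝ) + 2) * R.phase := by
  obtain ⟨t₀, g, hi, hle, hg⟩ := hL.within hq hb
  refine ⟨T, g, ⟨t₀, hi, hle, m, k, T, hle, le_rfl, ?_, hc⟩, hg⟩
  rw [sub_self]
  exact h.keep_nonneg

theorem detection (h : R.Admissible) : R.Detection := by
  have hd := h.coherent.d_pos
  have hpos := h.phase_pos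
  have hpd : R.phase = R.skew + 2 * R.d := rfl
  have hsk := h.anchors.skew_nonneg
  constructor
  · intro q₁ hq₁ p m k t₁ g₁ hk ha q hq
    have hkp : R.keep = 2 * (R.f * R.phase) + 3 * R.phase := by unfold keep; ring
    have hag : R.durAgr = 2 * (R.f * R.phase) + R.phase := by unfold durAgr; ring
    have hkf : (k : ℝ) * R.phase ≤ R.f * R.phase :=
      mul_le_mul_of_nonneg_right (by exact_mod_cast hk) hpos.le
    rcases h.acceptCond_of_acceptsAt hq₁ ha with ⟨hw, hc⟩ | ⟨hrun, hc⟩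
    · obtain ⟨S, hS, hcS, s, hs, u, hu, -, hsend, hsent⟩ :=
        h.exists_last_sender hq₁ hw.running hc
      obtain ⟨hws, -⟩ := (h.follows.echo s hs p m k).1 u hu hsend
      -- The acceptance time t₁ may be arbitrarily late, so only the echo sender's deadline 2kΦ can
      -- be used here.
      obtain ⟨L, hL, huL⟩ := h.synced_of_within hs hws (by linarith)
      have h1 := h.sentBy_initPrime hL hS hcS hsent (by linarith) (by linarith)
      have hL' : R.Synced L (u + 3 * R.d) := hL.mono (by linarith)
      have hcard : Fintype.card Node - 2 * R.f ≤ (R.correct : Set Node).ncard := by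
        rw [Set.ncard_coe_finset]
        exact (Nat.sub_le_sub_left (by omega) _).trans h.coherent.quorum
      exact h.exists_hasBroadcasterAt hL' hq (by linarith)
        (h.broadcasterCond_of_initPrime hL' subset_rfl hcard h1 (by linarith) (by linarith)
          (by linarith) hq)
    · obtain ⟨-, -, -, s₀, hs₀, v, hv, -, hsv, -⟩ := h.exists_last_sender hq₁ hrun hc
      obtain ⟨s₁, hs₁, w, -, hw, hcw⟩ := h.exists_first_echoPrime hs₀ hv hsv
      obtain ⟨S, hS, hcS, s, hs, u, hu, -, hsend, hsent⟩ :=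
        h.exists_last_sender hs₁ hw.running hcw
      obtain ⟨hws, -⟩ := (h.follows.initPrime s hs p m k).1 u hu hsend
      -- The init' deadline (2k + 1)Φ reaches Δ_agr exactly when k = f.
      obtain ⟨L, hL, huL⟩ := h.synced_of_within hs hws (by linarith)
      exact h.exists_hasBroadcasterAt hL hq (by linarith)
        (h.broadcasterCond_of_initPrime hL hS hcS hsent (by linarith) (by linarith)
          (by linarith) hq)
  · rintro p hp hno q hq ⟨t, g, t₀, -, -, m, k, s, -, -, -, hw, hc⟩
    obtain ⟨s', hs', v, hv, -, hsv⟩ := h.exists_sent_of_quorum hq hw.running hc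
    obtain ⟨u, hu, -, hi⟩ := h.exists_invoke_of_initPrime hp hs' hv hsv
    exact hno ⟨m, k, u, h.exists_broadcastsAt_of_invoke hp hu hi⟩

end Admissible

end Run

theorem mainTheorem3 {Node Val : Type*} [Fintype Node] (R : Run Node Val)
    (hn : 3 * R.f < Fintype.card Node) (hcoh : R.Coherent) (hanchor : R.AnchorsSupplied)
    (hprim : R.FollowsPrimitive) :
    R.Correctness ∧ R.Unforgeability ∧ R.Relay ∧ R.Detection := by
  have h : R.Admissible := ⟨hn, hcoh, hanchor, hprim⟩
  exact ⟨h.correctness, h.unforgeability, h.relay, h.detection⟩
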